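/- **Lemma 3.7 (Kernel decomposition).** Let $D\subset\mathbb{R}^n$ and $\Omega\subset\mathbb{R}^m$ be bounded open sets, and let $\Phi\in C(\overline{D};L^2(\Omega))$, i.e. $\Phi:\overline D\times\Omega\to\mathbb R$ is measurable, $\Phi(y,\cdot)\in L^2(\Omega)$ for every $y\in\overline D$, and $\|\Phi(z,\cdot)-\Phi(y,\cdot)\|_{L^2(\Omega)}\to 0$ as $z\to y$ in $\overline D$. Let $K_\Phi(y,z)=\int_\Omega \Phi(y,x)\Phi(z,x)\,dx$ and let $T_\Phi:L^2(D)\to L^2(D)$ be the integral operator $(T_\Phi\phi)(y)=\int_D K_\Phi(y,z)\phi(z)\,dz$. Then all the eigenvalues of $T_\Phi$ can be listed in a sequence $\{\lambda_k\}_{k=1}^\infty$, each nonzero eigenvalue being repeated according to its multiplicity (the dimension of its eigenspace), while the entry $0$ may occur any number of times (in particular, a finite list is continued by zeros). For every such sequence, in any order, all $\lambda_k$ are non-negative, and for each $N\in\mathbb{N}$ (including $N=0$) there exist $\Psi\in C(\overline{D};\mathbb{R}^N)$ and $\Xi\in L^2(\Omega;\mathbb{R}^N)$ such that $$\|\Phi-\Psi\cdot\Xi\|_{L^2(D\times\Omega)}^2=\sum_{k=N+1}^\infty\lambda_k<\infty,$$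 where $(\Psi\cdot\Xi)(y,x)=\Psi(y)\cdot\Xi(x)$. -/

import Mathlib

open MeasureTheory Filter Topology

noncomputable section

/-- The class `C(D̄; L²(Ω))`: functions `Φ`, (Lebesgue) measurable on `D̄ × Ω`, with
`Φ(y, ·) ∈ L²(Ω)` for every `y ∈ D̄` and `‖Φ(y, ·) - Φ(z, ·)‖_{L²(Ω)} → 0` as `z → y` in `D̄`.
Only the values on `D̄ × Ω` matter. -/
structure MemCL2 {n m : ℕ} (D : Set (EuclideanSpace ℝ (Fin n)))
    (Ω : Set (EuclideanSpace ℝ (Fin m)))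
    (Φ : EuclideanSpace ℝ (Fin n) → EuclideanSpace ℝ (Fin m) → ℝ) : Prop where
  aestronglyMeasurable : AEStronglyMeasurable (Function.uncurry Φ)
    ((volume.restrict (closure D)).prod (volume.restrict Ω))
  memLp : ∀ y ∈ closure D, MemLp (Φ y) 2 (volume.restrict Ω)
  tendsto : ∀ y ∈ closure D,
    Tendsto (fun z => eLpNorm (Φ z - Φ y) 2 (volume.restrict Ω)) (𝓝[closure D] y) (𝓝 0)

/-- Mercer's kernel `K_Φ(y, z) = ∫_Ω Φ(y, x) Φ(z, x) dx`. -/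
def mercerKernel {n m : ℕ} (Ω : Set (EuclideanSpace ℝ (Fin m)))
    (Φ : EuclideanSpace ℝ (Fin n) → EuclideanSpace ℝ (Fin m) → ℝ)
    (y z : EuclideanSpace ℝ (Fin n)) : ℝ :=
  ∫ x in Ω, Φ y x * Φ z x

theorem MemCL2.continuousOn_mercerKernel {n m : ℕ} {D : Set (EuclideanSpace ℝ (Fin n))}
    {Ω : Set (EuclideanSpace ℝ (Fin m))}
    {Φ : EuclideanSpace ℝ (Fin n) → EuclideanSpace ℝ (Fin m) → ℝ} (hΦ : MemCL2 D Ω Φ) :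
    ContinuousOn (Function.uncurry (mercerKernel Ω Φ)) (closure D ×ˢ closure D) := by
  classical
  let F : closure D → Lp ℝ 2 (volume.restrict Ω) := fun y => (hΦ.memLp y y.2).toLp
  have hF : Continuous F := by
    rw [continuous_iff_continuousAt]
    intro y
    rw [ContinuousAt, Lp.tendsto_Lp_iff_tendsto_eLpNorm']
    have h := (hΦ.tendsto y y.2).comp (tendsto_nhdsWithin_iff.2
      ⟨(continuous_subtype_val.tendsto y), Eventually.of_forall fun z => z.2⟩)
    refine h.congr fun z => ?_
    refine eLpNorm_congr_ae ?_
    filter_upwards [(hΦ.memLp z z.2).coeFn_toLp, (hΦ.memLp y y.2).coeFn_toLp] with x h1 h2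
    simp [F, h1, h2]
  have hK : ∀ y z : closure D, mercerKernel Ω Φ y z = inner ℝ (F z) (F y) := by
    intro y z
    rw [L2.inner_def]
    refine integral_congr_ae ?_
    filter_upwards [(hΦ.memLp z z.2).coeFn_toLp, (hΦ.memLp y y.2).coeFn_toLp] with x h1 h2
    simp [F, h1, h2]
  rw [continuousOn_iff_continuous_domRestrict]
  have hc : Continuous fun p : (closure D ×ˢ closure D : Set _) =>
      (inner ℝ (F ⟨p.1.2, p.2.2⟩) (F ⟨p.1.1, p.2.1⟩) : ℝ) := by
    refine Continuous.inner (hF.comp ?_) (hF.comp ?_)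
    · exact (continuous_snd.comp continuous_subtype_val).subtype_mk _
    · exact (continuous_fst.comp continuous_subtype_val).subtype_mk _
  refine hc.congr fun p => ?_
  exact (hK ⟨p.1.1, p.2.1⟩ ⟨p.1.2, p.2.2⟩).symm

section Operator

variable {n m : ℕ} {D : Set (EuclideanSpace ℝ (Fin n))} {Ω : Set (EuclideanSpace ℝ (Fin m))}
  {Φ : EuclideanSpace ℝ (Fin n) → EuclideanSpace ℝ (Fin m) → ℝ}

theorem MemCL2.exists_bound (hΦ : MemCL2 D Ω Φ) (hDb : Bornology.IsBounded D) :
    ∃ C : ℝ, ∀ y ∈ D, ∀ z ∈ D, ‖mercerKernel Ω Φ y z‖ ≤ C := by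
  have hc : IsCompact (closure D) := hDb.isCompact_closure
  obtain ⟨C, hC⟩ := (hc.prod hc).exists_bound_of_continuousOn hΦ.continuousOn_mercerKernel
  exact ⟨C, fun y hy z hz => hC (y, z) ⟨subset_closure hy, subset_closure hz⟩⟩

theorem MemCL2.aestronglyMeasurable_kernel (hΦ : MemCL2 D Ω Φ) (hD : IsOpen D) :
    AEStronglyMeasurable (Function.uncurry (mercerKernel Ω Φ))
      ((volume.restrict D).prod (volume.restrict D)) := by
  rw [Measure.prod_restrict]
  exact (hΦ.continuousOn_mercerKernel.mono
    (Set.prod_mono subset_closure subset_closure)).aestronglyMeasurable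
    (hD.measurableSet.prod hD.measurableSet)

theorem MemCL2.integrable_kernel_mul (hΦ : MemCL2 D Ω Φ) (hD : IsOpen D)
    (hDb : Bornology.IsBounded D) (φ : Lp ℝ 2 (volume.restrict D))
    {y : EuclideanSpace ℝ (Fin n)} (hy : y ∈ D) :
    Integrable (fun z => mercerKernel Ω Φ y z * φ z) (volume.restrict D) := by
  have : IsFiniteMeasure (volume.restrict D) :=
    isFiniteMeasure_restrict.2 hDb.measure_lt_top.ne
  obtain ⟨C, hC⟩ := hΦ.exists_bound hDb
  have hφ : Integrable φ (volume.restrict D) := (Lp.memLp φ).integrable (by norm_num)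
  refine hφ.bdd_mul (c := C) ?_ ?_
  · refine ContinuousOn.aestronglyMeasurable ?_ hD.measurableSet
    exact hΦ.continuousOn_mercerKernel.comp (f := fun z => (y, z)) (by fun_prop)
      fun z hz => ⟨subset_closure hy, subset_closure hz⟩
  · filter_upwards [ae_restrict_mem hD.measurableSet] with z hz using hC y hy z hz

theorem MemCL2.memLp_integral (hΦ : MemCL2 D Ω Φ) (hD : IsOpen D)
    (hDb : Bornology.IsBounded D) (φ : Lp ℝ 2 (volume.restrict D)) :
    MemLp (fun y => ∫ z in D, mercerKernel Ω Φ y z * φ z) 2 (volume.restrict D) := by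
  have : IsFiniteMeasure (volume.restrict D) :=
    isFiniteMeasure_restrict.2 hDb.measure_lt_top.ne
  obtain ⟨C, hC⟩ := hΦ.exists_bound hDb
  have hφ : Integrable φ (volume.restrict D) := (Lp.memLp φ).integrable (by norm_num)
  refine MemLp.of_bound ?_ (∫ z in D, C * ‖φ z‖) ?_
  · have h2 : AEStronglyMeasurable (fun p : EuclideanSpace ℝ (Fin n) × EuclideanSpace ℝ (Fin n) =>
        φ p.2) ((volume.restrict D).prod (volume.restrict D)) :=
      (Lp.aestronglyMeasurable φ).comp_snd
    exact ((hΦ.aestronglyMeasurable_kernel hD).mul h2).integral_prod_right'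
  · filter_upwards [ae_restrict_mem hD.measurableSet] with y hy
    refine norm_integral_le_of_norm_le (hφ.norm.const_mul C) ?_
    filter_upwards [ae_restrict_mem hD.measurableSet] with z hz
    rw [norm_mul]
    exact mul_le_mul_of_nonneg_right (hC y hy z hz) (norm_nonneg _)

/-- The integral operator `T_Φ : L²(D) → L²(D)`, `(T_Φ φ)(y) = ∫_D K_Φ(y, z) φ(z) dz`,
for `Φ ∈ C(D̄; L²(Ω))` and `D` open and bounded. -/
def mercerOperator (hΦ : MemCL2 D Ω Φ) (hD : IsOpen D) (hDb : Bornology.IsBounded D) :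
    Lp ℝ 2 (volume.restrict D) →ₗ[ℝ] Lp ℝ 2 (volume.restrict D) where
  toFun φ := (hΦ.memLp_integral hD hDb φ).toLp
  map_add' φ ψ := by
    rw [← MemLp.toLp_add, MemLp.toLp_eq_toLp_iff]
    filter_upwards [ae_restrict_mem hD.measurableSet] with y hy
    rw [Pi.add_apply, ← integral_add (hΦ.integrable_kernel_mul hD hDb φ hy)
      (hΦ.integrable_kernel_mul hD hDb ψ hy)]
    refine integral_congr_ae ?_
    filter_upwards [Lp.coeFn_add φ ψ] with z hz
    rw [hz, Pi.add_apply, mul_add]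
  map_smul' c φ := by
    rw [RingHom.id_apply, ← MemLp.toLp_const_smul, MemLp.toLp_eq_toLp_iff]
    refine Eventually.of_forall fun y => ?_
    simp only [Pi.smul_apply]
    rw [← integral_smul]
    refine integral_congr_ae ?_
    filter_upwards [Lp.coeFn_smul c φ] with z hz
    rw [hz, Pi.smul_apply, smul_eq_mul, smul_eq_mul]
    ring

end Operator

/-- `ev` lists all the eigenvalues of `T`, in any order: each nonzero real `μ` occurs in the
list exactly as often as the dimension of its eigenspace (never, if `μ` is not an eigenvalue).
The entry `0` may occur any number of times; so `ev` may be the list along an orthonormal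
basis of eigenvectors, or the nonincreasing list, continued by zeros if it would be finite. -/
def IsEigenvalueSequence {H : Type} [AddCommGroup H] [Module ℝ H] (T : H →ₗ[ℝ] H)
    (ev : ℕ → ℝ) : Prop :=
  ∀ μ : ℝ, μ ≠ 0 → Cardinal.mk {k : ℕ // ev k = μ} = Module.rank ℝ (Module.End.eigenspace T μ)

end

/-! View `Φ` as an element `f` of the Bochner space `L²(D; L²(Ω))` and let `A : L²(Ω) → L²(D)` be
`(A h)(y) = ⟪h, Φ(y, ·)⟫`. Then `T_Φ = A A†`, and `A` is compact, being a norm limit of finite rank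
operators. Hence `A† A` has a Hilbert basis `b` of eigenvectors, with eigenvalues `‖A (b i)‖²`;
these sum to `∫ ‖f‖²` by Parseval, and away from `0` they are the eigenvalues of `A A†` with the
same multiplicities. Listing eigenvectors `g k` along the sequence `λ k` (with `g k = 0` where
`λ k = 0`), subtracting from `f` its projection onto the span of the first `N` of them lowers
`∫ ‖f‖²` by `∑_{k < N} ‖A (g k)‖² = ∑_{k < N} λ k`. So `Ψ k y = ⟪g k, Φ(y, ·)⟫` and `Ξ k = g k`
realise the tail of the eigenvalue sum. -/

section Reindexing

variable {α β M : Type*} [Zero M]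

theorem exists_equiv_support_of_fibers {u : α → M} {v : β → M}
    (h : ∀ c ≠ 0, Nonempty ({a // u a = c} ≃ {b // v b = c})) :
    ∃ σ : Function.support u ≃ Function.support v, ∀ a, v (σ a) = u a := by
  have hfib (c : M) : Nonempty
      ({a : Function.support u // u a = c} ≃ {b : Function.support v // v b = c}) := by
    by_cases hc : c = 0
    · have : IsEmpty {a : Function.support u // u a = c} := ⟨fun a => a.1.2 (a.2.trans hc)⟩
      have : IsEmpty {b : Function.support v // v b = c} := ⟨fun b => b.1.2 (b.2.trans hc)⟩
      exact ⟨Equiv.equivOfIsEmpty _ _⟩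
    · obtain ⟨e⟩ := h c hc
      exact ⟨(Equiv.subtypeSubtypeEquivSubtype fun ha => ha.trans_ne hc).trans <|
        e.trans (Equiv.subtypeSubtypeEquivSubtype fun hb => hb.trans_ne hc).symm⟩
  let e : ∀ c, {a : Function.support u // u a = c} ≃ {b : Function.support v // v b = c} :=
    fun c => (hfib c).some
  exact ⟨Equiv.ofFiberEquiv e, Equiv.ofFiberEquiv_map e⟩

theorem exists_seq_fibers_equiv [Countable β] (v : β → M) :
    ∃ u : ℕ → M, ∀ c ≠ 0, Nonempty ({k // u k = c} ≃ {b // v b = c}) := by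
  obtain ⟨e, he⟩ := exists_injective_nat β
  refine ⟨Function.extend e v 0, fun c hc => ?_⟩
  have himage : {k | Function.extend e v 0 k = c} = e '' {b | v b = c} := by
    ext k
    by_cases hk : ∃ b, e b = k
    · obtain ⟨b, rfl⟩ := hk
      simp [he.extend_apply, he.eq_iff]
    · simp only [Set.mem_ofPred_eq, Function.extend_apply' _ _ _ hk, Pi.zero_apply, hc.symm,
        false_iff]
      exact fun ⟨b, _, hb⟩ => hk ⟨b, hb⟩
  exact ⟨(Equiv.setCongr himage).trans (Equiv.Set.image e _ he).symm⟩

end Reindexing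

section Orthonormal

variable {𝕜 E ι α : Type*} [RCLike 𝕜] [NormedAddCommGroup E] [InnerProductSpace 𝕜 E]

/-- An orthonormal family padded by zeros: the vectors are pairwise orthogonal, and each of them
is a unit vector or zero. -/
structure IsOrthonormalOrZero (𝕜 : Type*) [RCLike 𝕜] [InnerProductSpace 𝕜 E]
    (g : ι → E) : Prop where
  inner_eq_zero : Pairwise fun j k => inner 𝕜 (g j) (g k) = 0
  eq_zero_or_norm_eq_one : ∀ k, g k = 0 ∨ ‖g k‖ = 1

theorem isOrthonormalOrZero_extend {v : ι → E} (hv : Orthonormal 𝕜 v) {e : ι → α}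
    (he : Function.Injective e) : IsOrthonormalOrZero 𝕜 (Function.extend e v 0) where
  inner_eq_zero j k hjk := by
    by_cases hj : ∃ i, e i = j
    · by_cases hk : ∃ i, e i = k
      · obtain ⟨⟨i, rfl⟩, ⟨l, rfl⟩⟩ := hj, hk
        simpa only [he.extend_apply] using hv.2 (ne_of_apply_ne e hjk)
      · simp [Function.extend_apply' _ _ _ hk]
    · simp [Function.extend_apply' _ _ _ hj]
  eq_zero_or_norm_eq_one k := by
    by_cases hk : ∃ i, e i = k
    · obtain ⟨i, rfl⟩ := hk
      exact .inr (by rw [he.extend_apply, hv.1])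
    · exact .inl (Function.extend_apply' _ _ _ hk)

theorem IsOrthonormalOrZero.inner_sum_inner_smul {g : ι → E} (hg : IsOrthonormalOrZero 𝕜 g)
    {s : Finset ι} {k : ι} (hk : k ∈ s) (x : E) :
    inner 𝕜 (g k) (∑ j ∈ s, inner 𝕜 (g j) x • g j) = inner 𝕜 (g k) x := by
  rw [inner_sum, Finset.sum_eq_single_of_mem k hk fun j _ hj => by
    rw [inner_smul_right, hg.inner_eq_zero hj.symm, mul_zero]]
  obtain h | h := hg.eq_zero_or_norm_eq_one k
  · simp [h]
  · rw [inner_smul_right, inner_self_eq_norm_sq_to_K, h]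
    simp

theorem IsOrthonormalOrZero.norm_sub_sum_inner_smul_sq {g : ι → E}
    (hg : IsOrthonormalOrZero 𝕜 g) (s : Finset ι) (x : E) :
    ‖x - ∑ k ∈ s, inner 𝕜 (g k) x • g k‖ ^ 2 = ‖x‖ ^ 2 - ∑ k ∈ s, ‖inner 𝕜 (g k) x‖ ^ 2 := by
  set p := ∑ k ∈ s, inner 𝕜 (g k) x • g k with hp
  have horth : inner 𝕜 p (x - p) = 0 := by
    rw [hp, sum_inner, ← hp]
    refine Finset.sum_eq_zero fun k hk => ?_
    rw [inner_smul_left, inner_sub_right, hg.inner_sum_inner_smul hk, sub_self, mul_zero]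
  have hpx : inner 𝕜 p x = ((∑ k ∈ s, ‖inner 𝕜 (g k) x‖ ^ 2 : ℝ) : 𝕜) := by
    simp only [hp, sum_inner, inner_smul_left, RCLike.conj_mul, RCLike.ofReal_sum,
      RCLike.ofReal_pow]
  have hpp : ‖p‖ ^ 2 = ∑ k ∈ s, ‖inner 𝕜 (g k) x‖ ^ 2 := by
    rw [← RCLike.ofReal_inj (K := 𝕜), ← hpx, RCLike.ofReal_pow, ← inner_self_eq_norm_sq_to_K]
    rw [inner_sub_right, sub_eq_zero] at horth
    exact horth.symm
  have hpyth := norm_add_sq (𝕜 := 𝕜) p (x - p)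
  rw [add_sub_cancel, horth, map_zero, mul_zero, add_zero] at hpyth
  rw [hpyth, hpp, add_sub_cancel_left]

theorem countable_of_orthonormal [TopologicalSpace.SeparableSpace E] {v : ι → E}
    (hv : Orthonormal 𝕜 v) : Countable ι := by
  have hdist {i j : ι} (hij : i ≠ j) : 1 ≤ dist (v i) (v j) := by
    have hpyth : ‖v i - v j‖ ^ 2 = 2 := by
      rw [norm_sub_sq (𝕜 := 𝕜), hv.2 hij, hv.1, hv.1]
      norm_num
    rw [dist_eq_norm]
    nlinarith [norm_nonneg (v i - v j)]
  refine Pairwise.countable_of_isOpen_disjoint (s := fun i => Metric.ball (v i) (1 / 2)) ?_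
    (fun _ => Metric.isOpen_ball) fun i => Metric.nonempty_ball.2 (by norm_num)
  exact fun i j hij => Metric.ball_disjoint_ball (by linarith [hdist hij])

end Orthonormal

section Eigenbasis

open Module.End Submodule

universe u v

variable {𝕜 : Type u} {E : Type v} [RCLike 𝕜] [NormedAddCommGroup E] [InnerProductSpace 𝕜 E]

theorem exists_hilbertBasis_of_orthogonalFamily [CompleteSpace E] {γ : Type u}
    {V : γ → Submodule 𝕜 E} [∀ c, CompleteSpace (V c)]
    (hV : OrthogonalFamily 𝕜 (fun c => V c) fun c => (V c).subtypeₗᵢ) (hbot : (⨆ c, V c)ᗮ = ⊥) :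
    ∃ (ι : Type (max u v)) (b : HilbertBasis ι 𝕜 E) (p : ι → γ), ∀ i, b i ∈ V (p i) := by
  choose w b _ using fun c => exists_hilbertBasis 𝕜 (V c)
  let v (a : Σ c, w c) : E := b a.1 a.2
  have hv : Orthonormal 𝕜 v := hV.orthonormal_sigma_orthonormal fun c => (b c).orthonormal
  have hspan : (span 𝕜 (Set.range v))ᗮ = ⊥ := by
    rw [eq_bot_iff, ← hbot]
    intro x hx
    rw [← iInf_orthogonal]
    refine (Submodule.mem_iInf _).2 fun c => ?_
    have hzero : (innerSL 𝕜 x).comp (V c).subtypeL = 0 := by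
      refine ContinuousLinearMap.ext_on
        (dense_iff_topologicalClosure_eq_top.2 (b c).dense_span) ?_
      rintro _ ⟨i, rfl⟩
      have hmem : v ⟨c, i⟩ ∈ span 𝕜 (Set.range v) := subset_span (Set.mem_range_self _)
      exact inner_left_of_mem_orthogonal hmem hx
    exact (mem_orthogonal' _ _).2 fun y hy => DFunLike.congr_fun hzero (⟨y, hy⟩ : V c)
  exact ⟨_, .mkOfOrthogonalEqBot hv hspan, Sigma.fst, fun a => by
    rw [HilbertBasis.coe_mkOfOrthogonalEqBot]; exact (b a.1 a.2).2⟩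

theorem exists_hilbertBasis_eigenvectors [CompleteSpace E] {T : E →L[𝕜] E}
    (hT : IsCompactOperator T) (hsymm : T.IsSymmetric) :
    ∃ (ι : Type (max u v)) (b : HilbertBasis ι 𝕜 E) (ev : ι → 𝕜), ∀ i, T (b i) = ev i • b i := by
  obtain ⟨ι, b, ev, hb⟩ := exists_hilbertBasis_of_orthogonalFamily
    hsymm.orthogonalFamily_eigenspaces
    (ContinuousLinearMap.orthogonalComplement_iSup_eigenspaces_eq_bot hT hsymm)
  exact ⟨ι, b, ev, fun i => mem_eigenspace_iff.1 (hb i)⟩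

section HilbertBasis

variable {ι : Type*} {b : HilbertBasis ι 𝕜 E} {T : E →L[𝕜] E} {ev : ι → 𝕜}

theorem inner_hilbertBasis_apply_of_eigenvectors (hb : ∀ i, T (b i) = ev i • b i) (i : ι) (x : E) :
    inner 𝕜 (b i) (T x) = ev i * inner 𝕜 (b i) x := by
  classical
  refine DFunLike.congr_fun (f := (innerSL 𝕜 (b i)).comp T) (g := ev i • innerSL 𝕜 (b i))
    (ContinuousLinearMap.ext_on (dense_iff_topologicalClosure_eq_top.2 b.dense_span) ?_) x
  rintro _ ⟨j, rfl⟩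
  obtain rfl | hij := eq_or_ne i j
  · simp [hb]
  · simp [hb, b.orthonormal.2 hij]

theorem eigenspace_eq_topologicalClosure_span (hb : ∀ i, T (b i) = ev i • b i) (c : 𝕜) :
    eigenspace (T : Module.End 𝕜 E) c =
      (span 𝕜 (Set.range fun i : {i // ev i = c} => b i)).topologicalClosure := by
  refine le_antisymm (fun x hx => ?_) (topologicalClosure_minimal _ ?_ (T.isClosed_eigenspace c))
  · refine mem_closure_of_tendsto (b.hasSum_repr x) (Eventually.of_forall fun s => ?_)
    refine sum_mem fun i _ => ?_
    by_cases hi : ev i = c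
    · exact smul_mem _ _ (subset_span ⟨⟨i, hi⟩, rfl⟩)
    · have hcoeff : (ev i - c) * inner 𝕜 (b i) x = 0 := by
        have hTx : T x = c • x := mem_eigenspace_iff.1 hx
        rw [sub_mul, ← inner_hilbertBasis_apply_of_eigenvectors hb, hTx, inner_smul_right, sub_self]
      rw [b.repr_apply_apply, (mul_eq_zero.1 hcoeff).resolve_left (sub_ne_zero.2 hi), zero_smul]
      exact zero_mem _
  · rw [span_le]
    rintro _ ⟨⟨i, rfl⟩, rfl⟩
    exact mem_eigenspace_iff.2 (hb i)

theorem nonempty_basis_eigenspace (hb : ∀ i, T (b i) = ev i • b i) (c : 𝕜)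
    [FiniteDimensional 𝕜 (eigenspace (T : Module.End 𝕜 E) c)] :
    Nonempty (Module.Basis {i // ev i = c} 𝕜 (eigenspace (T : Module.End 𝕜 E) c)) := by
  have hclosure := eigenspace_eq_topologicalClosure_span hb c
  have : FiniteDimensional 𝕜 (span 𝕜 (Set.range fun i : {i // ev i = c} => b i)) :=
    finiteDimensional_of_le (hclosure.symm ▸ le_topologicalClosure _)
  rw [(closed_of_finiteDimensional _).submodule_topologicalClosure_eq] at hclosure
  have hli := b.orthonormal.linearIndependent.comp (Subtype.val : {i // ev i = c} → ι)
    Subtype.val_injective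
  exact ⟨(Module.Basis.span hli).map (.ofEq _ _ hclosure.symm)⟩

end HilbertBasis

end Eigenbasis

section Commutation

open Module.End

variable {K V W : Type*} [Field K] [AddCommGroup V] [Module K V] [AddCommGroup W] [Module K W]

/-- For `c ≠ 0`, `R` maps the `c`-eigenspace of `S ∘ R` isomorphically onto that of `R ∘ S`; the
inverse is `c⁻¹ • S`. -/
def eigenspaceCompEquiv (R : V →ₗ[K] W) (S : W →ₗ[K] V) {c : K} (hc : c ≠ 0) :
    eigenspace (S ∘ₗ R : Module.End K V) c ≃ₗ[K] eigenspace (R ∘ₗ S : Module.End K W) c where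
  toFun x := ⟨R x, mem_eigenspace_iff.2 <|
    (congrArg R (mem_eigenspace_iff.1 x.2)).trans (R.map_smul c x)⟩
  map_add' x y := Subtype.ext (R.map_add x y)
  map_smul' a x := Subtype.ext (R.map_smul a x)
  invFun y := ⟨c⁻¹ • S y, Submodule.smul_mem _ _ <| mem_eigenspace_iff.2 <|
    (congrArg S (mem_eigenspace_iff.1 y.2)).trans (S.map_smul c y)⟩
  left_inv x := Subtype.ext <| by
    have hx : S (R x) = c • (x : V) := mem_eigenspace_iff.1 x.2
    simp [hx, hc]
  right_inv y := Subtype.ext <| by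
    have hy : R (S y) = c • (y : W) := mem_eigenspace_iff.1 y.2
    simp [hy, hc]

end Commutation

section SingularValues

open ContinuousLinearMap Module.End

universe u v

theorem exists_hilbertBasis_adjoint_comp_self {𝕜 : Type u} {H : Type v} {K : Type*} [RCLike 𝕜]
    [NormedAddCommGroup H] [InnerProductSpace 𝕜 H] [CompleteSpace H]
    [NormedAddCommGroup K] [InnerProductSpace 𝕜 K] [CompleteSpace K]
    {A : H →L[𝕜] K} (hA : IsCompactOperator A) :
    ∃ (ι : Type (max u v)) (b : HilbertBasis ι 𝕜 H),
      ∀ i, (adjoint A ∘L A) (b i) = ((‖A (b i)‖ ^ 2 : ℝ) : 𝕜) • b i := by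
  obtain ⟨ι, b, ev, hb⟩ := exists_hilbertBasis_eigenvectors (hA.clm_comp (adjoint A))
    (isPositive_adjoint_comp_self A).isSymmetric
  refine ⟨ι, b, fun i => ?_⟩
  have hev : ((‖A (b i)‖ ^ 2 : ℝ) : 𝕜) = ev i := by
    have hinner : inner 𝕜 (b i) ((adjoint A ∘L A) (b i)) = ev i := by
      rw [hb, inner_smul_right, inner_self_eq_norm_sq_to_K, b.orthonormal.1 i]
      simp
    rw [← hinner, comp_apply, adjoint_inner_right, inner_self_eq_norm_sq_to_K, RCLike.ofReal_pow]
  rw [hev, hb]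

variable {H K : Type} [NormedAddCommGroup H] [InnerProductSpace ℝ H] [CompleteSpace H]
  [NormedAddCommGroup K] [InnerProductSpace ℝ K] [CompleteSpace K] {A : H →L[ℝ] K}

theorem isEigenvalueSequence_comp_adjoint_iff (hA : IsCompactOperator A) {ι : Type}
    {b : HilbertBasis ι ℝ H} (hb : ∀ i, (adjoint A ∘L A) (b i) = ‖A (b i)‖ ^ 2 • b i)
    {ev : ℕ → ℝ} :
    IsEigenvalueSequence (A ∘L adjoint A : K →L[ℝ] K).toLinearMap ev ↔
      ∀ c ≠ 0, Nonempty ({k // ev k = c} ≃ {i // ‖A (b i)‖ ^ 2 = c}) := by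
  refine forall₂_congr fun c hc => ?_
  have := finite_dimensional_eigenspace (T := adjoint A ∘L A) (hA.clm_comp (adjoint A)) c hc
  obtain ⟨w⟩ := nonempty_basis_eigenspace hb c
  rw [← Cardinal.eq, (w.map (eigenspaceCompEquiv A.toLinearMap (adjoint A) hc)).mk_eq_rank'']
  rfl

theorem exists_isEigenvalueSequence_comp_adjoint [TopologicalSpace.SeparableSpace H]
    (hA : IsCompactOperator A) :
    ∃ ev, IsEigenvalueSequence (A ∘L adjoint A : K →L[ℝ] K).toLinearMap ev := by
  obtain ⟨ι, b, hb⟩ := exists_hilbertBasis_adjoint_comp_self hA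
  have := countable_of_orthonormal b.orthonormal
  obtain ⟨ev, hev⟩ := exists_seq_fibers_equiv fun i => ‖A (b i)‖ ^ 2
  exact ⟨ev, (isEigenvalueSequence_comp_adjoint_iff hA hb).2 hev⟩

theorem IsEigenvalueSequence.exists_singularVectors (hA : IsCompactOperator A) {ev : ℕ → ℝ}
    (hev : IsEigenvalueSequence (A ∘L adjoint A : K →L[ℝ] K).toLinearMap ev) :
    ∃ (ι : Type) (b : HilbertBasis ι ℝ H) (g : ℕ → H), IsOrthonormalOrZero ℝ g ∧
      (∀ k, ev k = ‖A (g k)‖ ^ 2) ∧ ∀ s, HasSum ev s ↔ HasSum (fun i => ‖A (b i)‖ ^ 2) s := by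
  obtain ⟨ι, b, hb⟩ := exists_hilbertBasis_adjoint_comp_self hA
  obtain ⟨σ, hσ⟩ := exists_equiv_support_of_fibers
    ((isEigenvalueSequence_comp_adjoint_iff hA hb).1 hev)
  refine ⟨ι, b, Function.extend Subtype.val (fun k => b (σ k)) 0,
    isOrthonormalOrZero_extend (b.orthonormal.comp _ (Subtype.val_injective.comp σ.injective))
      Subtype.val_injective, fun k => ?_, fun s => σ.hasSum_iff_of_support hσ⟩
  by_cases hk : ev k = 0
  · rw [Function.extend_apply' _ _ _ fun ⟨j, hj⟩ => j.2 (hj ▸ hk), hk]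
    simp
  · have hextend := Subtype.val_injective.extend_apply (fun k => b (σ k)) 0
      (⟨k, hk⟩ : Function.support ev)
    rw [hextend, hσ]

end SingularValues

section InnerCompLp

variable {X H : Type*} [MeasurableSpace X] {μ : Measure X} [NormedAddCommGroup H]
  [InnerProductSpace ℝ H]

/-- The operator `A_f : H → L²(μ)`, `A_f h = ⟪h, f ·⟫`, attached to `f ∈ L²(μ; H)`, as a bounded
bilinear map in `f` and `h`. -/
noncomputable def innerCompLp (μ : Measure X) (H : Type*) [NormedAddCommGroup H]
    [InnerProductSpace ℝ H] : Lp H 2 μ →L[ℝ] H →L[ℝ] Lp ℝ 2 μ :=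
  ((innerSL ℝ : H →L[ℝ] H →L[ℝ] ℝ).compLpL₂ 2 μ).flip

theorem coeFn_innerCompLp (f : Lp H 2 μ) (h : H) :
    innerCompLp μ H f h =ᵐ[μ] fun x => inner ℝ h (f x) :=
  (innerSL ℝ h).coeFn_compLp f

theorem innerCompLp_indicatorConstLp {s : Set X} (hs : MeasurableSet s) (hμs : μ s ≠ ⊤) (c : H) :
    innerCompLp μ H (indicatorConstLp 2 hs hμs c) =
      (ContinuousLinearMap.toSpanSingleton ℝ (indicatorConstLp 2 hs hμs (1 : ℝ))).comp
        (innerSL ℝ c) := by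
  ext1 h
  refine Lp.ext ?_
  rw [ContinuousLinearMap.comp_apply, innerSL_apply_apply,
    ContinuousLinearMap.toSpanSingleton_apply]
  filter_upwards [coeFn_innerCompLp (indicatorConstLp 2 hs hμs c) h,
    indicatorConstLp_coeFn (p := 2) (hs := hs) (hμs := hμs) (c := c),
    Lp.coeFn_smul (inner ℝ c h) (indicatorConstLp 2 hs hμs (1 : ℝ)),
    indicatorConstLp_coeFn (p := 2) (hs := hs) (hμs := hμs) (c := (1 : ℝ))]
    with x hinner hc hsmul hone
  rw [hinner, hc, hsmul, Pi.smul_apply, hone]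
  by_cases hx : x ∈ s <;> simp [hx, real_inner_comm]

theorem isCompactOperator_innerCompLp (f : Lp H 2 μ) : IsCompactOperator (innerCompLp μ H f) := by
  refine Lp.induction (by norm_num) (motive := fun f => IsCompactOperator (innerCompLp μ H f))
    (fun c s hs hμs => ?_) (fun f g hf hg _ hAf hAg => ?_) ?_ f
  · rw [Lp.simpleFunc.coe_indicatorConst, innerCompLp_indicatorConstLp]
    exact (isCompactOperator_of_locallyCompactSpace_dom (innerSL ℝ c)).clm_comp
      (ContinuousLinearMap.toSpanSingleton ℝ (indicatorConstLp 2 hs hμs.ne (1 : ℝ)))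
  · rw [map_add]
    exact hAf.add hAg
  · exact (isClosed_setOfPred_isCompactOperator (σ₁₂ := RingHom.id ℝ)
      (M₁ := H) (M₂ := Lp ℝ 2 μ)).preimage (innerCompLp μ H).continuous

theorem integral_norm_sq_eq_norm_sq (f : Lp H 2 μ) : ∫ x, ‖f x‖ ^ 2 ∂μ = ‖f‖ ^ 2 := by
  simp only [← real_inner_self_eq_norm_sq, L2.inner_def]

theorem integral_inner_sq (f : Lp H 2 μ) (h : H) :
    ∫ x, inner ℝ h (f x) ^ 2 ∂μ = ‖innerCompLp μ H f h‖ ^ 2 := by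
  rw [← integral_norm_sq_eq_norm_sq]
  refine integral_congr_ae ?_
  filter_upwards [coeFn_innerCompLp f h] with x hx
  rw [hx, Real.norm_eq_abs, sq_abs]

theorem integrable_inner_sq (f : Lp H 2 μ) (h : H) :
    Integrable (fun x => inner ℝ h (f x) ^ 2) μ :=
  ((Lp.memLp f).const_inner h).integrable_sq

theorem hasSum_norm_innerCompLp_sq [TopologicalSpace.SeparableSpace H]
    (f : Lp H 2 μ) {ι : Type*} (b : HilbertBasis ι ℝ H) :
    HasSum (fun i => ‖innerCompLp μ H f (b i)‖ ^ 2) (‖f‖ ^ 2) := by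
  have := countable_of_orthonormal b.orthonormal
  have hparseval (h : H) : HasSum (fun i => inner ℝ (b i) h ^ 2) (‖h‖ ^ 2) := by
    simpa only [real_inner_self_eq_norm_sq, real_inner_comm, ← sq] using
      b.hasSum_inner_mul_inner h h
  have hint : Integrable (fun x => ‖f x‖ ^ 2) μ := (Lp.memLp f).integrable_norm_pow (by norm_num)
  rw [← integral_norm_sq_eq_norm_sq f]
  simp only [← integral_inner_sq]
  refine hasSum_integral_of_dominated_convergence (fun i x => inner ℝ (b i) (f x) ^ 2)
    (fun i => (integrable_inner_sq f (b i)).aestronglyMeasurable)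
    (fun i => .of_forall fun x => (Real.norm_of_nonneg (sq_nonneg _)).le)
    (.of_forall fun x => (hparseval (f x)).summable) ?_ (.of_forall fun x => hparseval (f x))
  simpa only [(hparseval _).tsum_eq] using hint

theorem integral_norm_sub_sum_inner_smul_sq (f : Lp H 2 μ) {κ : Type*} {g : κ → H}
    (hg : IsOrthonormalOrZero ℝ g) (s : Finset κ) :
    ∫ x, ‖f x - ∑ k ∈ s, inner ℝ (g k) (f x) • g k‖ ^ 2 ∂μ =
      ‖f‖ ^ 2 - ∑ k ∈ s, ‖innerCompLp μ H f (g k)‖ ^ 2 := by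
  simp only [hg.norm_sub_sum_inner_smul_sq, Real.norm_eq_abs, sq_abs]
  rw [integral_sub ((Lp.memLp f).integrable_norm_pow (by norm_num))
      (integrable_finsetSum s fun k _ => integrable_inner_sq f (g k)),
    integral_finsetSum s fun k _ => integrable_inner_sq f (g k), integral_norm_sq_eq_norm_sq]
  simp only [integral_inner_sq]

theorem IsEigenvalueSequence.exists_hasSum_integral {X H : Type} [MeasurableSpace X]
    {μ : Measure X} [NormedAddCommGroup H] [InnerProductSpace ℝ H] [CompleteSpace H]
    [TopologicalSpace.SeparableSpace H] {f : Lp H 2 μ} {ev : ℕ → ℝ}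
    (hev : IsEigenvalueSequence
      (innerCompLp μ H f ∘L (innerCompLp μ H f).adjoint).toLinearMap ev) :
    ∃ g : ℕ → H, (∀ k, ev k = ‖innerCompLp μ H f (g k)‖ ^ 2) ∧ ∀ N,
      HasSum (fun k => ev (N + k))
        (∫ x, ‖f x - ∑ k ∈ Finset.range N, inner ℝ (g k) (f x) • g k‖ ^ 2 ∂μ) := by
  obtain ⟨ι, b, g, hg, hevg, hsum⟩ := hev.exists_singularVectors (isCompactOperator_innerCompLp f)
  refine ⟨g, hevg, fun N => ?_⟩
  have htotal : HasSum ev (‖f‖ ^ 2) := (hsum _).2 (hasSum_norm_innerCompLp_sq f b)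
  rw [integral_norm_sub_sum_inner_smul_sq f hg]
  simpa only [hevg, add_comm] using (hasSum_nat_add_iff' N).2 htotal

end InnerCompLp

section ProductMeasure

theorem memLp_restrict_of_continuousOn {X E : Type*} [TopologicalSpace X] [MeasurableSpace X]
    [OpensMeasurableSpace X] [NormedAddCommGroup E] {μ : Measure X} [IsFiniteMeasureOnCompacts μ]
    {K : Set X} {u : X → E} (hu : ContinuousOn u K) (hK : IsCompact K) (hKm : MeasurableSet K)
    (p : ENNReal) : MemLp u p (μ.restrict K) := by
  have : IsFiniteMeasure (μ.restrict K) := isFiniteMeasure_restrict.2 hK.measure_ne_top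
  obtain ⟨C, hC⟩ := hK.exists_bound_of_continuousOn hu
  exact .of_bound (hu.aestronglyMeasurable_of_isCompact hK hKm) C
    ((ae_restrict_mem hKm).mono hC)

theorem toReal_eLpNorm_two_sq {X H : Type*} [MeasurableSpace X] {μ : Measure X}
    [NormedAddCommGroup H] [InnerProductSpace ℝ H] {u : X → H} (hu : MemLp u 2 μ) :
    (eLpNorm u 2 μ).toReal ^ 2 = ∫ x, ‖u x‖ ^ 2 ∂μ := by
  rw [← Lp.norm_toLp u hu, ← integral_norm_sq_eq_norm_sq]
  exact integral_congr_ae (hu.coeFn_toLp.mono fun x hx => by simp only [hx])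

variable {X Y : Type*} [MeasurableSpace X] [MeasurableSpace Y] {μ : Measure X} {ν : Measure Y}

theorem eLpNorm_prod_eq_eLpNorm [SFinite ν] {E : Type*} [NormedAddCommGroup E] {p : ENNReal}
    (hp0 : p ≠ 0) (hp : p ≠ ⊤) {G : X × Y → E} (hG : AEStronglyMeasurable G (μ.prod ν))
    {u : X → Lp E p ν} (hu : ∀ᵐ x ∂μ, u x =ᵐ[ν] fun y => G (x, y)) :
    eLpNorm G p (μ.prod ν) = eLpNorm u p μ := by
  rw [eLpNorm_eq_lintegral_rpow_enorm_toReal hp0 hp, eLpNorm_eq_lintegral_rpow_enorm_toReal hp0 hp,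
    lintegral_prod _ (hG.enorm.pow_const _)]
  congr 1
  refine lintegral_congr_ae (hu.mono fun x hx => ?_)
  dsimp only
  rw [Lp.enorm_def, eLpNorm_congr_ae hx, eLpNorm_eq_lintegral_rpow_enorm_toReal hp0 hp, one_div,
    ENNReal.rpow_inv_rpow (ENNReal.toReal_ne_zero.2 ⟨hp0, hp⟩)]

theorem coeFn_sub_sum_smul {κ : Type*} [Fintype κ] (u : Lp ℝ 2 ν) (a : κ → ℝ)
    (g : κ → Lp ℝ 2 ν) :
    u - ∑ k, a k • g k =ᵐ[ν]
      fun y => u y - inner ℝ (WithLp.toLp 2 a) (WithLp.toLp 2 fun k => g k y) := by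
  have hsmul : ∀ᵐ y ∂ν, ∀ k, (a k • g k : Lp ℝ 2 ν) y = a k * g k y :=
    ae_all_iff.2 fun k => Lp.coeFn_smul (a k) (g k)
  filter_upwards [Lp.coeFn_sub u (∑ k, a k • g k),
    Lp.coeFn_finsetSum Finset.univ fun k => a k • g k, hsmul] with y hsub hsum hsmul
  rw [hsub, Pi.sub_apply, hsum, Finset.sum_apply, PiLp.inner_apply]
  simp [hsmul, mul_comm]

end ProductMeasure

section MercerKernel

open ContinuousLinearMap

variable {n m : ℕ} {D : Set (EuclideanSpace ℝ (Fin n))} {Ω : Set (EuclideanSpace ℝ (Fin m))}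
  {Φ : EuclideanSpace ℝ (Fin n) → EuclideanSpace ℝ (Fin m) → ℝ}

open Classical in
/-- The map `y ↦ Φ(y, ·)` into `L²(Ω)`, extended by zero outside the closure of `D`. -/
noncomputable def MemCL2.toL2 (hΦ : MemCL2 D Ω Φ) (y : EuclideanSpace ℝ (Fin n)) :
    Lp ℝ 2 (volume.restrict Ω) :=
  if hy : y ∈ closure D then (hΦ.memLp y hy).toLp else 0

theorem MemCL2.coeFn_toL2 (hΦ : MemCL2 D Ω Φ) {y : EuclideanSpace ℝ (Fin n)}
    (hy : y ∈ closure D) : hΦ.toL2 y =ᵐ[volume.restrict Ω] Φ y := by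
  rw [toL2, dif_pos hy]
  exact (hΦ.memLp y hy).coeFn_toLp

theorem MemCL2.continuousOn_toL2 (hΦ : MemCL2 D Ω Φ) : ContinuousOn hΦ.toL2 (closure D) := by
  intro y hy
  rw [ContinuousWithinAt, Lp.tendsto_Lp_iff_tendsto_eLpNorm']
  refine (hΦ.tendsto y hy).congr' ?_
  filter_upwards [self_mem_nhdsWithin] with z hz
  exact eLpNorm_congr_ae ((hΦ.coeFn_toL2 hz).sub (hΦ.coeFn_toL2 hy)).symm

theorem MemCL2.inner_toL2 (hΦ : MemCL2 D Ω Φ) {y z : EuclideanSpace ℝ (Fin n)}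
    (hy : y ∈ closure D) (hz : z ∈ closure D) :
    inner ℝ (hΦ.toL2 y) (hΦ.toL2 z) = mercerKernel Ω Φ y z := by
  rw [L2.inner_def]
  refine integral_congr_ae ?_
  filter_upwards [hΦ.coeFn_toL2 hy, hΦ.coeFn_toL2 hz] with x hxy hxz
  rw [hxy, hxz, real_inner_eq_re_inner, RCLike.inner_apply, mul_comm]
  simp

theorem memLp_restrict_of_continuousOn_closure {E : Type*} [NormedAddCommGroup E]
    {u : EuclideanSpace ℝ (Fin n) → E} (hu : ContinuousOn u (closure D))
    (hDb : Bornology.IsBounded D) (p : ENNReal) : MemLp u p (volume.restrict D) :=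
  (memLp_restrict_of_continuousOn hu hDb.isCompact_closure isClosed_closure.measurableSet
    p).mono_measure (Measure.restrict_mono subset_closure le_rfl)

/-- The function `Φ` as an element of the Bochner space `L²(D; L²(Ω))`. -/
noncomputable def MemCL2.toBochnerL2 (hΦ : MemCL2 D Ω Φ) (hDb : Bornology.IsBounded D) :
    Lp (Lp ℝ 2 (volume.restrict Ω)) 2 (volume.restrict D) :=
  (memLp_restrict_of_continuousOn_closure hΦ.continuousOn_toL2 hDb 2).toLp

theorem MemCL2.coeFn_toBochnerL2 (hΦ : MemCL2 D Ω Φ) (hDb : Bornology.IsBounded D) :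
    hΦ.toBochnerL2 hDb =ᵐ[volume.restrict D] hΦ.toL2 :=
  (memLp_restrict_of_continuousOn_closure hΦ.continuousOn_toL2 hDb 2).coeFn_toLp

theorem MemCL2.mercerOperator_apply_of_ae_eq (hΦ : MemCL2 D Ω Φ) (hD : IsOpen D)
    (hDb : Bornology.IsBounded D) {f : Lp (Lp ℝ 2 (volume.restrict Ω)) 2 (volume.restrict D)}
    (hf : f =ᵐ[volume.restrict D] hΦ.toL2) (φ : Lp ℝ 2 (volume.restrict D)) :
    mercerOperator hΦ hD hDb φ = innerCompLp _ _ f (adjoint (innerCompLp _ _ f) φ) := by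
  refine Lp.ext ?_
  filter_upwards [ae_restrict_mem hD.measurableSet, hf,
    coeFn_innerCompLp f (adjoint (innerCompLp _ _ f) φ),
    (hΦ.memLp_integral hD hDb φ).coeFn_toLp] with y hy hfy hAy hTy
  rw [hAy, hfy, adjoint_inner_left, L2.inner_def]
  refine Eq.trans hTy (integral_congr_ae ?_)
  filter_upwards [ae_restrict_mem hD.measurableSet, hf,
    coeFn_innerCompLp f (hΦ.toL2 y)] with z hz hfz hAz
  rw [hAz, hfz, hΦ.inner_toL2 (subset_closure hy) (subset_closure hz), real_inner_eq_re_inner,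
    RCLike.inner_apply]
  simp

theorem MemCL2.mercerOperator_eq_comp_adjoint (hΦ : MemCL2 D Ω Φ) (hD : IsOpen D)
    (hDb : Bornology.IsBounded D) :
    mercerOperator hΦ hD hDb =
      (innerCompLp _ _ (hΦ.toBochnerL2 hDb) ∘L
        adjoint (innerCompLp _ _ (hΦ.toBochnerL2 hDb))).toLinearMap :=
  LinearMap.ext <| hΦ.mercerOperator_apply_of_ae_eq hD hDb (hΦ.coeFn_toBochnerL2 hDb)

theorem MemCL2.aestronglyMeasurable_sub_inner (hΦ : MemCL2 D Ω Φ) {F : Type*}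
    [NormedAddCommGroup F] [InnerProductSpace ℝ F] {Ψ : EuclideanSpace ℝ (Fin n) → F}
    {Ξ : EuclideanSpace ℝ (Fin m) → F} (hΨ : AEStronglyMeasurable Ψ (volume.restrict D))
    (hΞ : AEStronglyMeasurable Ξ (volume.restrict Ω)) :
    AEStronglyMeasurable (fun p : EuclideanSpace ℝ (Fin n) × EuclideanSpace ℝ (Fin m) =>
      Φ p.1 p.2 - inner ℝ (Ψ p.1) (Ξ p.2)) ((volume.restrict D).prod (volume.restrict Ω)) :=
  (hΦ.aestronglyMeasurable.mono_measure
    (Measure.prod_mono (Measure.restrict_mono subset_closure le_rfl) le_rfl)).sub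
    (hΨ.comp_fst.inner hΞ.comp_snd)

theorem MemCL2.exists_approx (hΦ : MemCL2 D Ω Φ) (hD : IsOpen D) (hDb : Bornology.IsBounded D)
    {κ : Type*} [Fintype κ] (g : κ → Lp ℝ 2 (volume.restrict Ω)) :
    ∃ (Ψ : EuclideanSpace ℝ (Fin n) → EuclideanSpace ℝ κ)
      (Ξ : EuclideanSpace ℝ (Fin m) → EuclideanSpace ℝ κ),
      ContinuousOn Ψ (closure D) ∧ MemLp Ξ 2 (volume.restrict Ω) ∧
      MemLp (fun p : EuclideanSpace ℝ (Fin n) × EuclideanSpace ℝ (Fin m) =>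
        Φ p.1 p.2 - inner ℝ (Ψ p.1) (Ξ p.2)) 2
        ((volume.restrict D).prod (volume.restrict Ω)) ∧
      (eLpNorm (fun p : EuclideanSpace ℝ (Fin n) × EuclideanSpace ℝ (Fin m) =>
        Φ p.1 p.2 - inner ℝ (Ψ p.1) (Ξ p.2)) 2
        ((volume.restrict D).prod (volume.restrict Ω))).toReal ^ 2 =
        ∫ y in D, ‖hΦ.toBochnerL2 hDb y - ∑ k, inner ℝ (g k) (hΦ.toBochnerL2 hDb y) • g k‖ ^ 2 := by
  let Ψ (y : EuclideanSpace ℝ (Fin n)) : EuclideanSpace ℝ κ :=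
    WithLp.toLp 2 fun k => inner ℝ (g k) (hΦ.toL2 y)
  let Ξ (x : EuclideanSpace ℝ (Fin m)) : EuclideanSpace ℝ κ := WithLp.toLp 2 fun k => g k x
  let u (y : EuclideanSpace ℝ (Fin n)) : Lp ℝ 2 (volume.restrict Ω) :=
    hΦ.toL2 y - ∑ k, inner ℝ (g k) (hΦ.toL2 y) • g k
  have hinner (k : κ) : ContinuousOn (fun y => inner ℝ (g k) (hΦ.toL2 y)) (closure D) :=
    continuousOn_const.inner hΦ.continuousOn_toL2
  have hΨ : ContinuousOn Ψ (closure D) :=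
    (PiLp.continuous_toLp 2 _).comp_continuousOn (continuousOn_pi.2 hinner)
  have hΞ : MemLp Ξ 2 (volume.restrict Ω) := memLp_piLp_iff.2 fun k => Lp.memLp (g k)
  have hmeas := hΦ.aestronglyMeasurable_sub_inner
    (memLp_restrict_of_continuousOn_closure hΨ hDb 2).aestronglyMeasurable hΞ.aestronglyMeasurable
  have hu : MemLp u 2 (volume.restrict D) := memLp_restrict_of_continuousOn_closure
    (hΦ.continuousOn_toL2.sub <|
      continuousOn_finsetSum _ fun k _ => (hinner k).smul continuousOn_const) hDb 2
  have hslice : ∀ᵐ y ∂volume.restrict D,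
      u y =ᵐ[volume.restrict Ω] fun x => Φ y x - inner ℝ (Ψ y) (Ξ x) := by
    filter_upwards [ae_restrict_mem hD.measurableSet] with y hy
    exact (coeFn_sub_sum_smul _ _ g).trans
      ((hΦ.coeFn_toL2 (subset_closure hy)).sub (ae_eq_refl _))
  have hnorm := eLpNorm_prod_eq_eLpNorm two_ne_zero ENNReal.ofNat_ne_top hmeas hslice
  refine ⟨Ψ, Ξ, hΨ, hΞ, ⟨hmeas, hnorm ▸ hu.eLpNorm_lt_top⟩, ?_⟩
  rw [hnorm, toReal_eLpNorm_two_sq hu]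
  refine integral_congr_ae ?_
  filter_upwards [hΦ.coeFn_toBochnerL2 hDb] with y hy
  rw [hy]

end MercerKernel

theorem lemma3p7_general {n m : ℕ} (D : Set (EuclideanSpace ℝ (Fin n)))
    (Ω : Set (EuclideanSpace ℝ (Fin m)))
    (hD : IsOpen D) (hDb : Bornology.IsBounded D)
    (Φ : EuclideanSpace ℝ (Fin n) → EuclideanSpace ℝ (Fin m) → ℝ)
    (hΦ : MemCL2 D Ω Φ) :
    (∃ ev : ℕ → ℝ, IsEigenvalueSequence (mercerOperator hΦ hD hDb) ev) ∧
    ∀ ev : ℕ → ℝ, IsEigenvalueSequence (mercerOperator hΦ hD hDb) ev →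
      (∀ k, 0 ≤ ev k) ∧
      ∀ N : ℕ, ∃ (Ψ : EuclideanSpace ℝ (Fin n) → EuclideanSpace ℝ (Fin N))
        (Ξ : EuclideanSpace ℝ (Fin m) → EuclideanSpace ℝ (Fin N)),
        ContinuousOn Ψ (closure D) ∧
        MemLp Ξ 2 (volume.restrict Ω) ∧
        MemLp (fun p : EuclideanSpace ℝ (Fin n) × EuclideanSpace ℝ (Fin m) =>
          Φ p.1 p.2 - inner ℝ (Ψ p.1) (Ξ p.2)) 2
          ((volume.restrict D).prod (volume.restrict Ω)) ∧
        HasSum (fun k : ℕ => ev (N + k))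
          ((eLpNorm (fun p : EuclideanSpace ℝ (Fin n) × EuclideanSpace ℝ (Fin m) =>
            Φ p.1 p.2 - inner ℝ (Ψ p.1) (Ξ p.2)) 2
            ((volume.restrict D).prod (volume.restrict Ω))).toReal ^ 2) := by
  have : Fact ((2 : ENNReal) ≠ ⊤) := ⟨ENNReal.ofNat_ne_top⟩
  rw [hΦ.mercerOperator_eq_comp_adjoint hD hDb]
  refine ⟨exists_isEigenvalueSequence_comp_adjoint (isCompactOperator_innerCompLp _),
    fun ev hev => ?_⟩
  obtain ⟨g, hg, hsum⟩ := hev.exists_hasSum_integral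
  refine ⟨fun k => hg k ▸ sq_nonneg _, fun N => ?_⟩
  obtain ⟨Ψ, Ξ, hΨ, hΞ, hmem, hnorm⟩ := hΦ.exists_approx hD hDb fun k : Fin N => g k
  refine ⟨Ψ, Ξ, hΨ, hΞ, hmem, ?_⟩
  rw [hnorm]
  simpa only [Finset.sum_range] using hsum N

theorem lemma3p7 {n m : ℕ} (D : Set (EuclideanSpace ℝ (Fin n)))
    (Ω : Set (EuclideanSpace ℝ (Fin m)))
    (hD : IsOpen D) (hDb : Bornology.IsBounded D)
    (hΩ : IsOpen Ω) (hΩb : Bornology.IsBounded Ω)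
    (Φ : EuclideanSpace ℝ (Fin n) → EuclideanSpace ℝ (Fin m) → ℝ)
    (hΦ : MemCL2 D Ω Φ) :
    (∃ ev : ℕ → ℝ, IsEigenvalueSequence (mercerOperator hΦ hD hDb) ev) ∧
    ∀ ev : ℕ → ℝ, IsEigenvalueSequence (mercerOperator hΦ hD hDb) ev →
      (∀ k, 0 ≤ ev k) ∧
      ∀ N : ℕ, ∃ (Ψ : EuclideanSpace ℝ (Fin n) → EuclideanSpace ℝ (Fin N))
        (Ξ : EuclideanSpace ℝ (Fin m) → EuclideanSpace ℝ (Fin N)),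
        ContinuousOn Ψ (closure D) ∧
        MemLp Ξ 2 (volume.restrict Ω) ∧
        MemLp (fun p : EuclideanSpace ℝ (Fin n) × EuclideanSpace ℝ (Fin m) =>
          Φ p.1 p.2 - inner ℝ (Ψ p.1) (Ξ p.2)) 2
          ((volume.restrict D).prod (volume.restrict Ω)) ∧
        HasSum (fun k : ℕ => ev (N + k))
          ((eLpNorm (fun p : EuclideanSpace ℝ (Fin n) × EuclideanSpace ℝ (Fin m) =>
            Φ p.1 p.2 - inner ℝ (Ψ p.1) (Ξ p.2)) 2
            ((volume.restrict D).prod (volume.restrict Ω))).toReal ^ 2) :=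
  lemma3p7_general D Ω hD hDb Φ hΦ
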